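/- Let $\mathcal G=(\mathcal V,\mathcal E)$ be a finite directed acyclic graph, possibly with parallel edges, with a source $s$ and a set $\mathcal T$ of sinks, $s\notin\mathcal T$. Let $C$ be its capacity, i.e. the minimum over $t\in\mathcal T$ of the min-cut from $s$ to $t$ (each edge having unit capacity), and let $R\le C$ be a nonnegative integer. The source has $R$ messages $X_1(z),\dots,X_R(z)\in\mathbb F_2[z]$, the $l$-th of which enters $s$ on the $l$-th of $R$ parallel virtual links from a virtual node to $s$. Edges and virtual links with the same tail and head are distinguished by their indices, and the nodes, including the virtual one, carry distinct integer IDs. In a linear network code each edge $e$ from $v$ to $w$, say the $j$-th one, carries $$Y_e(z)=\sum_{e'}\beta_{u,i,v,j,w}(z)\,Y_{e'}(z)\in\mathbb F_2(z),$$ where $e'$ ranges over all edges and virtual links that enter $v$, $e'$ being the $i$-th one from $u$ to $v$, and the $l$-th virtual link carries $X_l(z)$. The transfer matrix $T_t$ of $t\in\mathcal T$ is the matrix over $\mathbb F_2(z)$ that maps $(X_1,\dots,X_R)$ to the vector $\mathbf Y_t$ of the packets on all edges entering $t$. Let $K:\mathbb Z^5\to\mathbb N$ be the Cantor labeling, which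 enumerates the integer vectors by increasing largest absolute value of an entry, and lexicographically among vectors for which this value is the same. Then $K$ is a bijection. Moreover, for this $K$, and more generally for every injective map $K:\mathbb Z^5\to\mathbb N$, the code with local coding coefficients $$\beta_{u,i,v,j,w}(z)=z^{2^{K(u,i,v,j,w)}}$$ (nodes being represented by their IDs) has zero error on every such network for every $R\le C$ and every choice of the IDs: for each sink $t$ the transfer matrix $T_t$ has rank $R$ (in particular, it is invertible when it is square), and $t$ has a linear decoder over $\mathbb F_2(z)$ that recovers $X_1(z),\dots,X_R(z)$ from $\mathbf Y_t$ for all messages. -/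

import Mathlib

/-- A single-source multicast network: a directed acyclic multigraph with node type `V` and edge
type `E`, a source and a set of sinks (none of which is the source).  Parallel edges are told apart
by their index: `index e = i` means that `e` is the `i`th edge from `tail e` to `head e`. -/
structure Network (V E : Type*) where
  /-- the node at which an edge starts -/
  tail : E → V
  /-- the node at which an edge ends -/
  head : E → V
  /-- the number of an edge among the edges parallel to it -/
  index : E → ℕ
  index_injective : ∀ e e' : E, tail e = tail e' → head e = head e' → index e = index e' → e = e'
  acyclic : ∀ v : V, ¬ Relation.TransGen (fun u w => ∃ e, tail e = u ∧ head e = w) v v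
  /-- the source node -/
  source : V
  /-- the set of sink nodes -/
  sinks : Set V
  source_notMem_sinks : source ∉ sinks

/-- The field `𝔽₂(z)` of rational functions over the binary field; `RatFunc.X` is `z`. -/
abbrev BinRatFunc : Type := RatFunc (ZMod 2)

namespace Network

variable {V E : Type*} (N : Network V E)

/-- The min-cut from the source to `t`: the least number of edges that leave a set of nodes
containing the source but not `t`. -/
noncomputable def minCut (t : V) : ℕ∞ :=
  ⨅ (S : Set V) (_ : N.source ∈ S) (_ : t ∉ S), {e : E | N.tail e ∈ S ∧ N.head e ∉ S}.encard

/-- The network capacity: the minimum over the sinks of the min-cut from the source. -/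
noncomputable def capacity : ℕ∞ := ⨅ t ∈ N.sinks, N.minCut t

/-! The `R` source messages enter the network on `R` parallel virtual links, which lead from a
virtual node to the source.  A link of the extended network is thus an element of `Fin R ⊕ E`, and
its nodes are the elements of `Option V`, where `none` is the virtual node. -/

/-- The tail of a link. -/
def linkTail {R : ℕ} : Fin R ⊕ E → Option V
  | .inl _ => none
  | .inr e => some (N.tail e)

/-- The head of a link (never the virtual node). -/
def linkHead {R : ℕ} : Fin R ⊕ E → V
  | .inl _ => N.source
  | .inr e => N.head e

/-- The index of a link among the links parallel to it; the virtual links have the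
indices `1, …, R`. -/
def linkIndex {R : ℕ} : Fin R ⊕ E → ℕ
  | .inl l => (l : ℕ) + 1
  | .inr e => N.index e

/-- `ℓ'` feeds `ℓ` if `ℓ` is an edge of the network that starts where `ℓ'` ends. -/
def Feeds {R : ℕ} (ℓ' ℓ : Fin R ⊕ E) : Prop := ∃ e : E, ℓ = .inr e ∧ N.linkHead ℓ' = N.tail e

theorem feeds_wellFounded [Finite E] (R : ℕ) :
    WellFounded (N.Feeds : Fin R ⊕ E → Fin R ⊕ E → Prop) := by
  have key : ∀ a b : Fin R ⊕ E, Relation.TransGen N.Feeds a b → ∃ e : E, b = .inr e ∧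
      Relation.TransGen (fun u w => ∃ e, N.tail e = u ∧ N.head e = w)
        (N.linkHead a) (N.head e) := by
    intro a b h
    induction h with
    | single h =>
      obtain ⟨e, rfl, h⟩ := h
      exact ⟨e, rfl, .single ⟨e, h.symm, rfl⟩⟩
    | tail _ h ih =>
      obtain ⟨e, rfl, ih⟩ := ih
      obtain ⟨e', rfl, h⟩ := h
      exact ⟨e', rfl, ih.tail ⟨e', h.symm, rfl⟩⟩
  have : Std.Irrefl (Relation.TransGen (N.Feeds : Fin R ⊕ E → Fin R ⊕ E → Prop)) := ⟨by
    intro a h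
    obtain ⟨e, rfl, h⟩ := key a a h
    exact N.acyclic _ h⟩
  have wf : WellFounded (Relation.TransGen (N.Feeds : Fin R ⊕ E → Fin R ⊕ E → Prop)) :=
    Finite.wellFounded_of_trans_of_irrefl _
  exact Subrelation.wf (fun h => Relation.TransGen.single h) wf

open Classical in
/-- The packet carried by each link when the local coding coefficients are `β` and the source
messages are `X`: the `l`th virtual link carries `X l`, and an edge `e` carries the sum of
`β ℓ e * (packet on ℓ)` over all links `ℓ` that enter the tail of `e` (see `packet_inr`). -/
noncomputable def packet [Fintype E] {R : ℕ} (β : Fin R ⊕ E → E → BinRatFunc)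
    (X : Fin R → BinRatFunc) : Fin R ⊕ E → BinRatFunc :=
  (N.feeds_wellFounded R).fix fun ℓ rec =>
    match ℓ, rec with
    | .inl l, _ => X l
    | .inr e, rec => ∑ ℓ' : Fin R ⊕ E,
        if h : N.linkHead ℓ' = N.tail e then β ℓ' e * rec ℓ' ⟨e, rfl, h⟩ else 0

theorem packet_inl [Fintype E] {R : ℕ} (β : Fin R ⊕ E → E → BinRatFunc)
    (X : Fin R → BinRatFunc) (l : Fin R) : N.packet β X (.inl l) = X l := by
  rw [packet, WellFounded.fix_eq]

open Classical in
theorem packet_inr [Fintype E] {R : ℕ} (β : Fin R ⊕ E → E → BinRatFunc)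
    (X : Fin R → BinRatFunc) (e : E) :
    N.packet β X (.inr e) =
      ∑ ℓ' : Fin R ⊕ E with N.linkHead ℓ' = N.tail e, β ℓ' e * N.packet β X ℓ' := by
  rw [packet, WellFounded.fix_eq, Finset.sum_filter]
  refine Finset.sum_congr rfl fun ℓ' _ => ?_
  split_ifs <;> rfl

/-- The vector of the packets on the edges that enter the node `t`. -/
noncomputable def received [Fintype E] {R : ℕ} (β : Fin R ⊕ E → E → BinRatFunc)
    (X : Fin R → BinRatFunc) (t : V) : {e : E // N.head e = t} → BinRatFunc :=
  fun e => N.packet β X (.inr e)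

/-- The network transfer matrix from the source to the node `t`: its `l`th column is the vector that
`t` receives when the `l`th message is `1` and the other messages are `0`. -/
noncomputable def transferMatrix [Fintype E] {R : ℕ} (β : Fin R ⊕ E → E → BinRatFunc) (t : V) :
    Matrix {e : E // N.head e = t} (Fin R) BinRatFunc :=
  Matrix.of fun e l => N.received β (Pi.single l 1) t e

open Classical in
/-- The code given by `β` has zero error at rate `R`: every sink `t` has a linear decoder `D` which
reconstructs all the `R` source messages from the received packets, for all messages (binary
polynomials in `z`, of any length). -/
def ZeroError [Fintype E] {R : ℕ} (β : Fin R ⊕ E → E → BinRatFunc) : Prop :=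
  ∀ t ∈ N.sinks, ∃ D : Matrix (Fin R) {e : E // N.head e = t} BinRatFunc,
    ∀ X : Fin R → Polynomial (ZMod 2),
      D.mulVec (N.received β (fun l => algebraMap _ BinRatFunc (X l)) t) =
        fun l => algebraMap _ BinRatFunc (X l)

/-- The local coding coefficients `β_{u,i,v,j,w}(z) = z ^ (2 ^ K(u,i,v,j,w))`: here `ℓ` is the `i`th
link from `u` to `v`, `e` is the `j`th edge from `v` to `w`, nodes are represented by their integer
IDs, and `K` is the labeling in use.  (The value is used only when `ℓ` enters the tail of `e`.) -/
noncomputable def c3p0 (K : (Fin 5 → ℤ) → ℕ) (nodeID : Option V → ℤ) {R : ℕ}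
    (ℓ : Fin R ⊕ E) (e : E) : BinRatFunc :=
  RatFunc.X ^ 2 ^ K ![nodeID (N.linkTail ℓ), N.linkIndex ℓ, nodeID (some (N.tail e)),
    N.index e, nodeID (some (N.head e))]

end Network

/-- The largest absolute value of an entry of an integer vector. -/
def maxEntry {k : ℕ} (x : Fin k → ℤ) : ℕ := Finset.univ.sup fun i => (x i).natAbs

/-- The `k`-dimensional Cantor labeling: it enumerates the integer vectors of length `k` by
increasing largest entry, and lexicographically among vectors with the same largest entry.
The label of `x` is the number of vectors that come before `x`. -/
noncomputable def cantorLabel {k : ℕ} (x : Fin k → ℤ) : ℕ :=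
  {y : Fin k → ℤ | maxEntry y < maxEntry x ∨
    (maxEntry y = maxEntry x ∧ toLex y < toLex x)}.ncard

/-! ### The Cantor labeling -/

/-! Fix a sink `t` and treat the packets on all links as unknowns, with the coding rules and
"nothing arrives at `t`" as homogeneous equations. Every coefficient is `0`, `1` or `z ^ 2 ^ k`,
each label `k` sitting at a single position. Choose as many equations as unknowns. The exponent of a
nonzero Leibniz product is a sum of distinct powers of two; by uniqueness of binary expansion it
reveals the labels used, and these determine the permutation. Nothing cancels, so the determinant is
nonzero once one nonzero product exists (`systemMatrix_submatrix_det_ne_zero`). Such a product is a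
matching of links into equations, which Hall's theorem extracts from the min-cut bound
(`exists_matching`). Hence the transfer matrix has trivial kernel, which gives both the rank and the
decoder. The Cantor labeling counts predecessors in a linear order with finite initial segments, so
it is injective and its range has no gaps. -/

theorem finite_setOf_maxEntry_le (k n : ℕ) : {y : Fin k → ℤ | maxEntry y ≤ n}.Finite := by
  refine (Set.finite_Icc (fun _ : Fin k => -(n : ℤ)) (fun _ => (n : ℤ))).subset fun y hy => ?_
  have h : ∀ i, (y i).natAbs ≤ n := fun i =>
    (Finset.le_sup (f := fun i => (y i).natAbs) (Finset.mem_univ i)).trans hy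
  exact ⟨fun i => by have := h i; simp only; omega, fun i => by have := h i; simp only; omega⟩

/-- The linear order in which the Cantor labeling enumerates the vectors. -/
def cantorKey {k : ℕ} (x : Fin k → ℤ) : ℕ ×ₗ Lex (Fin k → ℤ) := toLex (maxEntry x, toLex x)

theorem cantorKey_injective {k : ℕ} : Function.Injective (cantorKey (k := k)) := by
  intro x y h
  exact toLex.injective (Prod.ext_iff.1 (toLex.injective h)).2

theorem cantorKey_lt_iff {k : ℕ} (x y : Fin k → ℤ) :
    cantorKey y < cantorKey x ↔ maxEntry y < maxEntry x ∨
      (maxEntry y = maxEntry x ∧ toLex y < toLex x) :=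
  Prod.Lex.toLex_lt_toLex

theorem cantorLabel_eq {k : ℕ} (x : Fin k → ℤ) :
    cantorLabel x = {y | cantorKey y < cantorKey x}.ncard := by
  simp only [cantorLabel, cantorKey_lt_iff]

theorem finite_setOf_cantorKey_lt {k : ℕ} (x : Fin k → ℤ) :
    {y | cantorKey y < cantorKey x}.Finite := by
  refine (finite_setOf_maxEntry_le k (maxEntry x)).subset fun y hy => ?_
  rcases (cantorKey_lt_iff x y).1 hy with h | h
  · exact h.le
  · exact h.1.le

theorem cantorLabel_lt {k : ℕ} {x y : Fin k → ℤ} (h : cantorKey x < cantorKey y) :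
    cantorLabel x < cantorLabel y := by
  rw [cantorLabel_eq, cantorLabel_eq]
  refine Set.ncard_lt_ncard ⟨fun z hz => lt_trans hz h, fun hs => ?_⟩ (finite_setOf_cantorKey_lt y)
  exact lt_irrefl _ (show cantorKey x < cantorKey x from hs h)

theorem cantorLabel_injective {k : ℕ} : Function.Injective (cantorLabel (k := k)) := by
  intro x y h
  rcases lt_trichotomy (cantorKey x) (cantorKey y) with hlt | heq | hlt
  · exact absurd h (cantorLabel_lt hlt).ne
  · exact cantorKey_injective heq
  · exact absurd h (cantorLabel_lt hlt).ne'

theorem exists_cantorLabel_eq_of_lt {k : ℕ} (x : Fin k → ℤ) {n : ℕ} (hn : n < cantorLabel x) :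
    ∃ y : Fin k → ℤ, cantorLabel y = n := by
  have hsub : cantorLabel '' {y | cantorKey y < cantorKey x} ⊆ Set.Iio (cantorLabel x) := by
    rintro _ ⟨y, hy, rfl⟩
    exact cantorLabel_lt hy
  -- Both sets have `cantorLabel x` elements, so every smaller number is the label of a predecessor.
  have heq := Set.eq_of_subset_of_ncard_le hsub (by
    rw [Set.ncard_image_of_injective _ cantorLabel_injective, ← cantorLabel_eq,
      Set.ncard_eq_toFinset_card']
    simp) (Set.finite_Iio _)
  obtain ⟨y, -, hy⟩ := heq.symm.subset hn
  exact ⟨y, hy⟩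

theorem cantorLabel_bijective {k : ℕ} [NeZero k] :
    Function.Bijective (cantorLabel : (Fin k → ℤ) → ℕ) := by
  refine ⟨cantorLabel_injective, fun n => ?_⟩
  obtain ⟨_, ⟨x, rfl⟩, hx⟩ :=
    (Set.infinite_range_of_injective (cantorLabel_injective (k := k))).exists_gt n
  exact exists_cantorLabel_eq_of_lt x hx

/-! ### Determinants with distinct monomials -/

/-- If the nonzero products in the Leibniz formula are distinct powers of the variable and there is
at least one of them, then the determinant does not vanish. -/
theorem det_ne_zero_of_distinct_monomials {F n : Type*} [Field F] [Fintype n] [DecidableEq n]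
    (M : Matrix n n (Polynomial F)) (d : Equiv.Perm n → ℕ) (P : Equiv.Perm n → Prop)
    (hP : ∀ σ, P σ → ∏ i, M (σ i) i = Polynomial.X ^ d σ)
    (hnP : ∀ σ, ¬ P σ → ∏ i, M (σ i) i = 0)
    (hd : ∀ σ τ, P σ → P τ → d σ = d τ → σ = τ) (σ₀ : Equiv.Perm n) (hσ₀ : P σ₀) :
    M.det ≠ 0 := by
  intro h
  -- Only `σ₀` contributes to this coefficient, which is therefore `±1`.
  have hc := congrArg (fun p => Polynomial.coeff p (d σ₀)) h
  simp only [Matrix.det_apply, Polynomial.finsetSum_coeff, Polynomial.coeff_zero] at hc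
  rw [Finset.sum_eq_single σ₀] at hc
  · rw [hP σ₀ hσ₀] at hc
    rcases Int.units_eq_one_or (Equiv.Perm.sign σ₀) with hs | hs <;> simp [hs] at hc
  · intro σ _ hne
    by_cases hσ : P σ
    · have hne' : d σ₀ ≠ d σ := fun e => hne (hd σ σ₀ hσ hσ₀ e.symm)
      rw [hP σ hσ]
      rcases Int.units_eq_one_or (Equiv.Perm.sign σ) with hs | hs <;>
        simp [hs, Polynomial.coeff_X_pow, hne']
    · simp [hnP σ hσ]
  · simp

namespace Network

variable {V E : Type*} (N : Network V E) {R : ℕ}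

theorem not_feeds_self [Finite E] (ℓ : Fin R ⊕ E) : ¬ N.Feeds ℓ ℓ :=
  fun h => (N.feeds_wellFounded R).asymmetric _ _ h h

theorem link_eq_of_tail_index_head {ℓ ℓ' : Fin R ⊕ E} (ht : N.linkTail ℓ = N.linkTail ℓ')
    (hh : N.linkHead ℓ = N.linkHead ℓ') (hi : N.linkIndex ℓ = N.linkIndex ℓ') : ℓ = ℓ' := by
  rcases ℓ with l | e <;> rcases ℓ' with l' | e'
  · simp only [linkIndex] at hi
    exact congrArg _ (Fin.ext (by omega))
  · simp [linkTail] at ht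
  · simp [linkTail] at ht
  · simp only [linkTail, Option.some.injEq] at ht
    exact congrArg _ (N.index_injective e e' ht hh hi)

/-- The argument of the labeling in the local coding coefficient from `ℓ` to `e`. -/
def labelArg (nodeID : Option V → ℤ) (ℓ : Fin R ⊕ E) (e : E) : Fin 5 → ℤ :=
  ![nodeID (N.linkTail ℓ), N.linkIndex ℓ, nodeID (some (N.tail e)), N.index e,
    nodeID (some (N.head e))]

/-- The last three entries pin down `e`. Since `ℓ` ends at the tail of `e`, the first two then pin
down `ℓ`. -/
theorem labelArg_injective {nodeID : Option V → ℤ} (hID : Function.Injective nodeID)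
    {ℓ ℓ' : Fin R ⊕ E} {e e' : E} (h : N.linkHead ℓ = N.tail e) (h' : N.linkHead ℓ' = N.tail e')
    (heq : N.labelArg nodeID ℓ e = N.labelArg nodeID ℓ' e') : ℓ = ℓ' ∧ e = e' := by
  have h0 := congrFun heq 0
  have h1 := congrFun heq 1
  have h2 := congrFun heq 2
  have h3 := congrFun heq 3
  have h4 := congrFun heq 4
  simp only [labelArg, Matrix.cons_val] at h0 h1 h2 h3 h4
  have he : e = e' := N.index_injective _ _ (Option.some.inj (hID h2)) (Option.some.inj (hID h4))
    (by exact_mod_cast h3)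
  subst he
  exact ⟨N.link_eq_of_tail_index_head (hID h0) (h.trans h'.symm) (by exact_mod_cast h1), rfl⟩

/-! ### The linear system of the packets -/

/-- The incidence relation of the linear system satisfied by the packets when nothing is received at
`t`: the unknowns are the packets on the links, and there is one equation for each edge (the coding
rule) and one for each edge entering `t` (its packet vanishes). -/
def Involves (t : V) : E ⊕ {e : E // N.head e = t} → Fin R ⊕ E → Prop
  | .inl e, ℓ => ℓ = .inr e ∨ N.linkHead ℓ = N.tail e
  | .inr e, ℓ => ℓ = .inr e.1

open Classical in
/-- The exponent of the coefficient of a link in an equation, as a set of binary digits. -/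
noncomputable def digits (κ : Fin R ⊕ E → E → ℕ) (t : V) :
    E ⊕ {e : E // N.head e = t} → Fin R ⊕ E → Finset ℕ
  | .inl e, ℓ => if ℓ = .inr e then ∅ else {κ ℓ e}
  | .inr _, _ => ∅

open Classical in
/-- The coefficients of the linear system, up to signs, for coding coefficients `X ^ 2 ^ κ`. -/
noncomputable def systemMatrix (κ : Fin R ⊕ E → E → ℕ) (t : V) :
    Matrix (E ⊕ {e : E // N.head e = t}) (Fin R ⊕ E) (Polynomial (ZMod 2)) :=
  Matrix.of fun r ℓ => match r with
    | .inl e => if ℓ = .inr e then 1 else if N.linkHead ℓ = N.tail e then Polynomial.X ^ 2 ^ κ ℓ e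
        else 0
    | .inr e => if ℓ = .inr e.1 then 1 else 0

theorem systemMatrix_of_involves (κ : Fin R ⊕ E → E → ℕ) {t : V}
    {r : E ⊕ {e : E // N.head e = t}} {ℓ : Fin R ⊕ E} (h : N.Involves t r ℓ) :
    N.systemMatrix κ t r ℓ = Polynomial.X ^ ∑ i ∈ N.digits κ t r ℓ, 2 ^ i := by
  rcases r with e | e
  · by_cases h1 : ℓ = .inr e
    · simp [systemMatrix, digits, h1]
    · simp [systemMatrix, digits, h1, h.resolve_left h1]
  · have h1 : ℓ = .inr e.1 := h
    simp [systemMatrix, digits, h1]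

theorem systemMatrix_of_not_involves (κ : Fin R ⊕ E → E → ℕ) {t : V}
    {r : E ⊕ {e : E // N.head e = t}} {ℓ : Fin R ⊕ E} (h : ¬ N.Involves t r ℓ) :
    N.systemMatrix κ t r ℓ = 0 := by
  rcases r with e | e
  · simp only [Involves, not_or] at h
    simp [systemMatrix, h.1, h.2]
  · have h1 : ¬ ℓ = .inr e.1 := h
    simp [systemMatrix, h1]

/-- Digits come only from genuine coding coefficients; entries equal to `1` have none. -/
theorem mem_digits {κ : Fin R ⊕ E → E → ℕ} {t : V} {r : E ⊕ {e : E // N.head e = t}}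
    {ℓ : Fin R ⊕ E} {k : ℕ} (h : N.Involves t r ℓ) (hk : k ∈ N.digits κ t r ℓ) :
    ∃ e, r = .inl e ∧ ℓ ≠ .inr e ∧ N.linkHead ℓ = N.tail e ∧ k = κ ℓ e := by
  rcases r with e | e
  · by_cases h1 : ℓ = .inr e
    · simp [digits, h1] at hk
    · exact ⟨e, rfl, h1, h.resolve_left h1, by simpa [digits, h1] using hk⟩
  · simp [digits] at hk

/-- A square subsystem with a perfect matching is nonsingular. -/
theorem systemMatrix_submatrix_det_ne_zero [Fintype E] [DecidableEq (Fin R ⊕ E)]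
    {κ : Fin R ⊕ E → E → ℕ}
    (hκ : ∀ ℓ ℓ' e e', N.linkHead ℓ = N.tail e → N.linkHead ℓ' = N.tail e' → κ ℓ e = κ ℓ' e' →
      ℓ = ℓ' ∧ e = e')
    {t : V} (m : Fin R ⊕ E → E ⊕ {e : E // N.head e = t}) (hm : Function.Injective m)
    (hinv : ∀ ℓ, N.Involves t (m ℓ) ℓ) :
    ((N.systemMatrix κ t).submatrix m id).det ≠ 0 := by
  classical
  let D : Equiv.Perm (Fin R ⊕ E) → Finset ℕ := fun σ =>
    Finset.univ.biUnion fun ℓ => N.digits κ t (m (σ ℓ)) ℓ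
  refine det_ne_zero_of_distinct_monomials _ (fun σ => ∑ i ∈ D σ, 2 ^ i)
    (fun σ => ∀ ℓ, N.Involves t (m (σ ℓ)) ℓ) ?_ ?_ ?_ 1 hinv
  · intro σ hσ
    -- A label determines its column, so no digit repeats and the exponents add without carries.
    have hdisj : ∀ ℓ ∈ (Finset.univ : Finset (Fin R ⊕ E)), ∀ ℓ' ∈ (Finset.univ : Finset _),
        ℓ ≠ ℓ' → Disjoint (N.digits κ t (m (σ ℓ)) ℓ) (N.digits κ t (m (σ ℓ')) ℓ') := by
      intro ℓ _ ℓ' _ hne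
      rw [Finset.disjoint_left]
      intro k hk hk'
      obtain ⟨e, -, -, h1, h2⟩ := N.mem_digits (hσ ℓ) hk
      obtain ⟨e', -, -, h1', h2'⟩ := N.mem_digits (hσ ℓ') hk'
      exact hne (hκ _ _ _ _ h1 h1' (h2.symm.trans h2')).1
    simp only [D]
    rw [Finset.sum_biUnion hdisj, ← Finset.prod_pow_eq_pow_sum]
    exact Finset.prod_congr rfl fun ℓ _ => N.systemMatrix_of_involves κ (hσ ℓ)
  · intro σ hσ
    obtain ⟨ℓ, hℓ⟩ := not_forall.1 hσ
    exact Finset.prod_eq_zero (Finset.mem_univ ℓ) (N.systemMatrix_of_not_involves κ hℓ)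
  · intro σ τ hσ hτ hd
    have hD : D σ = D τ := Finset.geomSum_injective le_rfl hd
    have key : ∀ σ τ : Equiv.Perm (Fin R ⊕ E), (∀ ℓ, N.Involves t (m (σ ℓ)) ℓ) →
        (∀ ℓ, N.Involves t (m (τ ℓ)) ℓ) → D σ ⊆ D τ → ∀ ℓ e, m (σ ℓ) = .inl e → ℓ ≠ .inr e →
        σ ℓ = τ ℓ := by
      intro σ τ hσ hτ hD ℓ e he hne
      have hk : κ ℓ e ∈ D σ :=
        Finset.mem_biUnion.2 ⟨ℓ, Finset.mem_univ _, by simp [he, digits, hne]⟩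
      obtain ⟨ℓ', -, hk'⟩ := Finset.mem_biUnion.1 (hD hk)
      obtain ⟨e', h0', -, h1', h2'⟩ := N.mem_digits (hτ ℓ') hk'
      have hf := hσ ℓ
      rw [he] at hf
      obtain ⟨rfl, rfl⟩ := hκ _ _ _ _ (hf.resolve_left hne) h1' h2'
      exact hm (he.trans h0'.symm)
    -- A coding row is matched either to its own edge or through a label, which `key` transfers to
    -- the other permutation. A row for an edge entering `t` admits only one column.
    have key' : ∀ i, σ.symm i = τ.symm i := by
      intro i
      rcases hi : m i with e | e
      · by_cases h1 : σ.symm i = .inr e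
        · by_cases h2 : τ.symm i = .inr e
          · rw [h1, h2]
          · have := key τ σ hτ hσ hD.symm.subset (τ.symm i) e (by simpa using hi) h2
            rw [Equiv.apply_symm_apply] at this
            rw [this, Equiv.symm_apply_apply, ← this]
        · have := key σ τ hσ hτ hD.subset (σ.symm i) e (by simpa using hi) h1
          rw [Equiv.apply_symm_apply] at this
          nth_rewrite 2 [this]
          rw [Equiv.symm_apply_apply]
      · have h1 := hσ (σ.symm i)
        have h2 := hτ (τ.symm i)
        rw [Equiv.apply_symm_apply, hi] at h1 h2
        exact Eq.trans h1 (Eq.symm h2)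
    exact Equiv.symm_bijective.injective (Equiv.ext key')

/-! ### The matching -/

/-- Hall's condition for the linear system, from the min-cut bound. -/
theorem exists_matching [Fintype E] {t : V} (hst : N.source ≠ t) (hcut : (R : ℕ∞) ≤ N.minCut t) :
    ∃ m : Fin R ⊕ E → E ⊕ {e : E // N.head e = t}, Function.Injective m ∧
      ∀ ℓ, N.Involves t (m ℓ) ℓ := by
  classical
  suffices h : ∃ m : Fin R ⊕ E → E ⊕ {e : E // N.head e = t}, Function.Injective m ∧
      ∀ ℓ, m ℓ ∈ Finset.univ.filter fun r => N.Involves t r ℓ by simpa using h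
  rw [← Finset.all_card_le_biUnion_card_iff_exists_injective]
  intro A
  rw [← Finset.card_toLeft_add_card_toRight (u := A)]
  set B := A.biUnion fun ℓ => Finset.univ.filter fun r => N.Involves t r ℓ with hB
  have memB : ∀ r, r ∈ B ↔ ∃ ℓ ∈ A, N.Involves t r ℓ := by simp [hB]
  have hright : A.toRight ⊆ B.toLeft := by
    intro e he
    rw [Finset.mem_toLeft, memB]
    exact ⟨.inr e, Finset.mem_toRight.1 he, .inl rfl⟩
  rcases A.toLeft.eq_empty_or_nonempty with hA | ⟨l, hl⟩
  · rw [hA, Finset.card_empty, zero_add]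
    exact (Finset.card_le_card hright).trans B.card_toLeft_le
  -- The virtual link `l` in `A` puts the source into `S`. An edge of `A` with head outside `S` must
  -- enter `t`.
  let S : Set V := {v | v ≠ t ∧ ∃ ℓ ∈ A, N.linkHead ℓ = v}
  let C : Finset E := Finset.univ.filter fun e => N.tail e ∈ S ∧ N.head e ∉ S
  have hC : R ≤ C.card := by
    have h1 : N.minCut t ≤ {e : E | N.tail e ∈ S ∧ N.head e ∉ S}.encard :=
      iInf_le_of_le S (iInf_le_of_le ⟨hst, .inl l, Finset.mem_toLeft.1 hl, rfl⟩
        (iInf_le_of_le (fun h => h.1 rfl) le_rfl))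
    have h2 : {e : E | N.tail e ∈ S ∧ N.head e ∉ S} = (C : Set E) := by ext; simp [C]
    rw [h2, Set.encard_coe_eq_coe_finsetCard] at h1
    exact_mod_cast hcut.trans h1
  have hleft : A.toLeft.card ≤ C.card :=
    ((Finset.card_le_univ _).trans_eq (Fintype.card_fin R)).trans hC
  have hout : C \ A.toRight ∪ A.toRight ⊆ B.toLeft := by
    refine Finset.union_subset (fun e he => ?_) hright
    obtain ⟨⟨-, ℓ, hℓ, hh⟩, -⟩ := (Finset.mem_filter.1 (Finset.mem_sdiff.1 he).1).2
    rw [Finset.mem_toLeft, memB]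
    exact ⟨ℓ, hℓ, .inr hh⟩
  have hin : C ∩ A.toRight ⊆ B.toRight.map (Function.Embedding.subtype _) := by
    intro e he
    obtain ⟨h1, h2⟩ := Finset.mem_inter.1 he
    have h2 := Finset.mem_toRight.1 h2
    have ht : N.head e = t := by
      by_contra hne
      exact (Finset.mem_filter.1 h1).2.2 ⟨hne, .inr e, h2, rfl⟩
    rw [Finset.mem_map]
    exact ⟨⟨e, ht⟩, Finset.mem_toRight.2 ((memB _).2 ⟨.inr e, h2, rfl⟩), rfl⟩
  -- Cut edges outside `A` give extra coding rows, and those inside `A` give vanishing rows at `t`.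
  -- Together they make up for the at most `R` virtual links in `A`.
  have c1 := Finset.card_le_card hout
  rw [Finset.card_union_of_disjoint Finset.sdiff_disjoint] at c1
  have c2 := Finset.card_le_card hin
  rw [Finset.card_map] at c2
  have c3 := Finset.card_sdiff_add_card_inter C A.toRight
  have c4 := Finset.card_toLeft_add_card_toRight (u := B)
  omega

/-! ### Decoding -/

/-- The packets depend linearly on the messages. -/
theorem packet_eq_sum [Fintype E] (β : Fin R ⊕ E → E → BinRatFunc) (X : Fin R → BinRatFunc)
    (ℓ : Fin R ⊕ E) : N.packet β X ℓ = ∑ l, N.packet β (Pi.single l 1) ℓ * X l := by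
  classical
  induction ℓ using (N.feeds_wellFounded R).induction with
  | _ ℓ ih =>
    rcases ℓ with l | e
    · simp [packet_inl, Pi.single_apply]
    · simp only [packet_inr, Finset.sum_mul]
      rw [Finset.sum_comm]
      refine Finset.sum_congr rfl fun ℓ' hℓ' => ?_
      rw [ih ℓ' ⟨e, rfl, (Finset.mem_filter.1 hℓ').2⟩, Finset.mul_sum]
      exact Finset.sum_congr rfl fun _ _ => (mul_assoc _ _ _).symm

theorem received_eq_mulVec [Fintype E] (β : Fin R ⊕ E → E → BinRatFunc) (X : Fin R → BinRatFunc)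
    (t : V) : N.received β X t = (N.transferMatrix β t).mulVec X := by
  funext e
  exact N.packet_eq_sum β X (.inr e)

/-- The packets solve the linear system if nothing is received. -/
theorem systemMatrix_mulVec_packet [Fintype E] (κ : Fin R ⊕ E → E → ℕ) {t : V}
    {X : Fin R → BinRatFunc} (h : N.received (fun ℓ e => RatFunc.X ^ 2 ^ κ ℓ e) X t = 0) :
    ((N.systemMatrix κ t).map (algebraMap _ BinRatFunc)).mulVec
      (N.packet (fun ℓ e => RatFunc.X ^ 2 ^ κ ℓ e) X) = 0 := by
  classical
  set p := N.packet (fun ℓ e => RatFunc.X ^ 2 ^ κ ℓ e) X with hp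
  funext r
  rcases r with e | e
  · have hsplit : ∀ ℓ, algebraMap _ BinRatFunc (N.systemMatrix κ t (.inl e) ℓ) * p ℓ =
        (if ℓ = .inr e then p ℓ else 0) +
          if N.linkHead ℓ = N.tail e then RatFunc.X ^ 2 ^ κ ℓ e * p ℓ else 0 := by
      intro ℓ
      by_cases h1 : ℓ = .inr e
      · have h2 : ¬ N.linkHead ℓ = N.tail e := fun h2 => N.not_feeds_self ℓ ⟨e, h1, h2⟩
        rw [if_neg h2]
        simp [systemMatrix, h1]
      · by_cases h2 : N.linkHead ℓ = N.tail e
        · simp [systemMatrix, h1, h2]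
        · simp [systemMatrix, h1, h2]
    simp only [Matrix.mulVec, dotProduct, Matrix.map_apply, hsplit, Finset.sum_add_distrib,
      Pi.zero_apply]
    rw [← Finset.sum_filter (fun ℓ => N.linkHead ℓ = N.tail e), hp]
    rw [← N.packet_inr (fun ℓ e => RatFunc.X ^ 2 ^ κ ℓ e) X e]
    simp only [Finset.sum_ite_eq', Finset.mem_univ, if_true]
    -- In characteristic two, the coding rule "packet equals sum" is the same as "packet plus sum
    -- vanishes".
    exact CharTwo.add_self_eq_zero _
  · have h1 : p (.inr e.1) = 0 := congrFun h e
    simp only [Matrix.mulVec, dotProduct, Matrix.map_apply, Pi.zero_apply]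
    refine Finset.sum_eq_zero fun ℓ _ => ?_
    by_cases h2 : ℓ = .inr e.1
    · rw [h2, h1, mul_zero]
    · simp [systemMatrix, h2]

/-- If the coding coefficients are distinct powers `X ^ 2 ^ k` and the rate is at most the min-cut
of `t`, then the messages are determined by what `t` receives. -/
theorem transferMatrix_mulVec_injective [Fintype E] {κ : Fin R ⊕ E → E → ℕ}
    (hκ : ∀ ℓ ℓ' e e', N.linkHead ℓ = N.tail e → N.linkHead ℓ' = N.tail e' → κ ℓ e = κ ℓ' e' →
      ℓ = ℓ' ∧ e = e')
    {t : V} (hst : N.source ≠ t) (hcut : (R : ℕ∞) ≤ N.minCut t) :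
    Function.Injective (N.transferMatrix (fun ℓ e => RatFunc.X ^ 2 ^ κ ℓ e) t).mulVec := by
  classical
  obtain ⟨m, hm, hinv⟩ := N.exists_matching hst hcut
  have hdet := N.systemMatrix_submatrix_det_ne_zero hκ m hm hinv
  rw [← Matrix.coe_mulVecLin, ← LinearMap.ker_eq_bot, LinearMap.ker_eq_bot']
  intro X hX
  rw [Matrix.mulVecLin_apply, ← received_eq_mulVec] at hX
  have hsys := N.systemMatrix_mulVec_packet κ hX
  have hdet' : (((N.systemMatrix κ t).map (algebraMap _ BinRatFunc)).submatrix m id).det ≠ 0 := by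
    rw [Matrix.submatrix_map, ← RingHom.mapMatrix_apply, ← RingHom.map_det]
    exact (map_ne_zero_iff _ (RatFunc.algebraMap_injective (ZMod 2))).2 hdet
  have hzero := Matrix.eq_zero_of_mulVec_eq_zero hdet' (funext fun ℓ => congrFun hsys (m ℓ))
  -- The messages are the packets on the virtual links, hence zero.
  funext l
  have := congrFun hzero (.inl l)
  rwa [packet_inl] at this

theorem zeroError_of_mulVec_injective [Fintype E] {β : Fin R ⊕ E → E → BinRatFunc}
    (h : ∀ t ∈ N.sinks, Function.Injective (N.transferMatrix β t).mulVec) : N.ZeroError β := by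
  classical
  intro t ht
  obtain ⟨g, hg⟩ := (N.transferMatrix β t).mulVecLin.exists_leftInverse_of_injective
    (LinearMap.ker_eq_bot.2 (h t ht))
  refine ⟨LinearMap.toMatrix' g, fun X => ?_⟩
  rw [LinearMap.toMatrix'_mulVec, received_eq_mulVec]
  exact LinearMap.congr_fun hg _

end Network

theorem theorem5 :
    Function.Bijective (cantorLabel : (Fin 5 → ℤ) → ℕ) ∧
    ∀ (K : (Fin 5 → ℤ) → ℕ), Function.Injective K →
      ∀ (V E : Type*) [Finite V] [Fintype E] (N : Network V E)
        (nodeID : Option V → ℤ), Function.Injective nodeID →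
        ∀ (R : ℕ), (R : ℕ∞) ≤ N.capacity →
          (∀ t ∈ N.sinks, (N.transferMatrix (R := R) (N.c3p0 K nodeID) t).rank = R) ∧
          N.ZeroError (R := R) (N.c3p0 K nodeID) := by
  refine ⟨cantorLabel_bijective, fun K hK V E _ _ N nodeID hID R hR => ?_⟩
  have hinj : ∀ t ∈ N.sinks, Function.Injective
      (N.transferMatrix (R := R) (N.c3p0 K nodeID) t).mulVec := fun t ht =>
    N.transferMatrix_mulVec_injective (κ := fun ℓ e => K (N.labelArg nodeID ℓ e))
      (fun _ _ _ _ h h' heq => N.labelArg_injective hID h h' (hK heq))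
      (fun h => N.source_notMem_sinks (h ▸ ht)) (hR.trans (iInf₂_le t ht))
  refine ⟨fun t ht => ?_, N.zeroError_of_mulVec_injective hinj⟩
  rw [Matrix.rank, LinearMap.finrank_range_of_inj (f := (N.transferMatrix _ t).mulVecLin) (hinj t ht),
    Module.finrank_fin_fun]
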